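/- Let $n$ be a positive integer, let $\mathcal{S}_n$ denote the real vector space of real symmetric $n\times n$ matrices, and let $$\mathrm{COP}_n=\{A\in\mathcal{S}_n : \mathbf{x}^TA\mathbf{x}\ge 0 \text{ for every entrywise nonnegative } \mathbf{x}\in\mathbb{R}^n\}$$ be the cone of copositive matrices. Call a square matrix monomial if each of its rows and each of its columns contains exactly one nonzero entry. Then a linear operator $\mathcal{L}:\mathcal{S}_n\to\mathcal{S}_n$ maps $\mathrm{COP}_n$ onto itself, that is, $\mathcal{L}(\mathrm{COP}_n)=\mathrm{COP}_n$, if and only if there is an entrywise nonnegative monomial matrix $Q\in\mathbb{R}^{n\times n}$ such that $$\mathcal{L}(A)=QAQ^T\quad\text{for all } A\in\mathcal{S}_n.$$ -/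

import Mathlib

open Matrix

/-- The real vector space of real symmetric `n × n` matrices, as a subspace of all real
`n × n` matrices. -/
def symMatrices (n : ℕ) : Submodule ℝ (Matrix (Fin n) (Fin n) ℝ) where
  carrier := {A | A.IsSymm}
  add_mem' hA hB := hA.add hB
  zero_mem' := Matrix.isSymm_zero
  smul_mem' c _ hA := hA.smul c

/-- The set of copositive matrices: real symmetric matrices `A` with `xᵀ A x ≥ 0` for every
entrywise nonnegative vector `x`. -/
def copositiveCone (n : ℕ) : Set (symMatrices n) :=
  {A | ∀ x : Fin n → ℝ, (∀ i, 0 ≤ x i) → 0 ≤ x ⬝ᵥ ((A : Matrix (Fin n) (Fin n) ℝ) *ᵥ x)}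

/-- A monomial matrix: exactly one nonzero entry in each row and in each column. -/
def IsMonomialMatrix {n : ℕ} (Q : Matrix (Fin n) (Fin n) ℝ) : Prop :=
  (∀ i, ∃! j, Q i j ≠ 0) ∧ (∀ j, ∃! i, Q i j ≠ 0)

/-- An entrywise nonnegative matrix. -/
def IsNonnegMatrix {n : ℕ} (Q : Matrix (Fin n) (Fin n) ℝ) : Prop :=
  ∀ i j, 0 ≤ Q i j

/-!
Linear automorphisms of the cone permute its facets. A functional `φ` defining a facet vanishes
only on copositive forms with a common zero `y ≥ 0`, and at such a zero the first-order condition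
`(A y) j = 0` holds whenever `y j > 0`; since the facet spans a hyperplane, these linear conditions
must all be proportional, which forces `y = e j`. So the facets are exactly the sets `A j j = 0`,
and an automorphism permutes and rescales the diagonal entries, as does some congruence
`A ↦ Q A Qᵀ` with `Q` nonnegative monomial.

It remains to see that an automorphism fixing all diagonals is the identity. By the inequality
`-√(A i i * A j j) ≤ A i j`, the matrix `u uᵀ` is the entrywise least copositive matrix with its
diagonal as soon as the entries of `u` have pairwise nonpositive products. Hence the automorphism
fixes `e i (e i)ᵀ` and `(e i - e j) (e i - e j)ᵀ`, and these matrices span.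
-/

section

variable {n : ℕ}

/-- The functional `A ↦ xᵀ A y` on symmetric matrices. It covers entries (`x`, `y` unit vectors),
entries of `A y` (`x` a unit vector) and values of the quadratic form (`x = y`). -/
def pairing (x y : Fin n → ℝ) : symMatrices n →ₗ[ℝ] ℝ where
  toFun A := x ⬝ᵥ (A.1 *ᵥ y)
  map_add' A B := by simp [add_mulVec]
  map_smul' c A := by simp [smul_mulVec]

theorem pairing_apply (x y : Fin n → ℝ) (A : symMatrices n) :
    pairing x y A = x ⬝ᵥ (A.1 *ᵥ y) := rfl

theorem pairing_comm (x y : Fin n → ℝ) (A : symMatrices n) : pairing x y A = pairing y x A := by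
  rw [pairing_apply, dotProduct_mulVec, ← mulVec_transpose, show A.1ᵀ = A.1 from A.2,
    dotProduct_comm, pairing_apply]

@[simp]
theorem pairing_single_single (i j : Fin n) (a b : ℝ) (A : symMatrices n) :
    pairing (Pi.single i a) (Pi.single j b) A = a * A.1 i j * b := by
  simp [pairing_apply, mulVec_single, mul_assoc, mul_comm b]

theorem pairing_self_smul (c : ℝ) (x : Fin n → ℝ) (A : symMatrices n) :
    pairing (c • x) (c • x) A = c ^ 2 * pairing x x A := by
  simp only [pairing_apply, mulVec_smul, smul_dotProduct, dotProduct_smul, smul_eq_mul]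
  ring

theorem pairing_self_add (x y : Fin n → ℝ) (A : symMatrices n) :
    pairing (x + y) (x + y) A = pairing x x A + 2 * pairing x y A + pairing y y A := by
  have hcomm := pairing_comm y x A
  simp only [pairing_apply, mulVec_add, add_dotProduct, dotProduct_add] at hcomm ⊢
  linarith

theorem pairing_self_smul_add_smul (s t : ℝ) (x y : Fin n → ℝ) (A : symMatrices n) :
    pairing (s • x + t • y) (s • x + t • y) A =
      s ^ 2 * pairing x x A + 2 * (s * t) * pairing x y A + t ^ 2 * pairing y y A := by
  rw [pairing_self_add, pairing_self_smul, pairing_self_smul]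
  simp only [pairing_apply, mulVec_smul, smul_dotProduct, dotProduct_smul, smul_eq_mul]
  ring

theorem continuous_pairing_self (A : symMatrices n) :
    Continuous fun x : Fin n → ℝ => pairing x x A := by
  simp only [pairing_apply]
  fun_prop

/-- The symmetrized outer product `(u wᵀ + w uᵀ) / 2`, normalized so that `symOuter u u = u uᵀ`. -/
noncomputable def symOuter (u w : Fin n → ℝ) : symMatrices n :=
  ⟨(1 / 2 : ℝ) • (vecMulVec u w + vecMulVec w u), by
    change (_ • _)ᵀ = _
    rw [transpose_smul, transpose_add, transpose_vecMulVec, transpose_vecMulVec, add_comm]⟩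

@[simp]
theorem symOuter_apply (u w : Fin n → ℝ) (i j : Fin n) :
    (symOuter u w).1 i j = (u i * w j + w i * u j) / 2 := by
  simp only [symOuter, Matrix.smul_apply, Matrix.add_apply, vecMulVec_apply, smul_eq_mul]
  ring

theorem pairing_symOuter (x y u w : Fin n → ℝ) :
    pairing x y (symOuter u w) = ((x ⬝ᵥ u) * (w ⬝ᵥ y) + (x ⬝ᵥ w) * (u ⬝ᵥ y)) / 2 := by
  simp only [pairing_apply, symOuter, smul_mulVec, add_mulVec, vecMulVec_mulVec, dotProduct_smul,
    dotProduct_add, smul_eq_mul, op_smul_eq_smul]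
  ring

theorem eq_sum_smul_symOuter_single (A : symMatrices n) :
    A = ∑ i, ∑ j, A.1 i j • symOuter (Pi.single i 1) (Pi.single j 1) := by
  have hA : A.1.IsSymm := A.2
  ext k l
  simp only [AddSubmonoidClass.coe_finsetSum, SetLike.val_smul, Matrix.sum_apply, Matrix.smul_apply,
    symOuter_apply, Pi.single_apply, smul_eq_mul, add_div, mul_add, Finset.sum_add_distrib]
  simp only [mul_ite, mul_one, mul_zero, ite_div, zero_div, Finset.sum_ite_irrel,
    Finset.sum_const_zero, Finset.sum_ite_eq, Finset.mem_univ, if_true, hA.apply k l]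
  ring

theorem linearMap_ext_symOuter_single {M : Type*} [AddCommMonoid M] [Module ℝ M]
    {f g : symMatrices n →ₗ[ℝ] M}
    (h : ∀ i j, f (symOuter (Pi.single i 1) (Pi.single j 1)) =
      g (symOuter (Pi.single i 1) (Pi.single j 1))) : f = g := by
  ext A
  rw [eq_sum_smul_symOuter_single A]
  simp only [map_sum, map_smul, h]

theorem symOuter_eq_half_smul (u w : Fin n → ℝ) :
    symOuter u w = (1 / 2 : ℝ) • (symOuter u u + symOuter w w - symOuter (u - w) (u - w)) := by
  ext i j
  simp only [SetLike.val_smul, AddSubgroupClass.coe_sub, Submodule.coe_add, Matrix.smul_apply,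
    Matrix.sub_apply, Matrix.add_apply, symOuter_apply, Pi.sub_apply, smul_eq_mul]
  ring

theorem mem_copositiveCone {A : symMatrices n} :
    A ∈ copositiveCone n ↔ ∀ x : Fin n → ℝ, 0 ≤ x → 0 ≤ pairing x x A := Iff.rfl

theorem symOuter_mem_copositiveCone {u w : Fin n → ℝ} (hu : 0 ≤ u) (hw : 0 ≤ w) :
    symOuter u w ∈ copositiveCone n := by
  rw [mem_copositiveCone]
  intro x hx
  rw [pairing_symOuter, dotProduct_comm w, dotProduct_comm u]
  have hxu := dotProduct_nonneg_of_nonneg hx hu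
  have hxw := dotProduct_nonneg_of_nonneg hx hw
  positivity

theorem symOuter_self_mem_copositiveCone (u : Fin n → ℝ) : symOuter u u ∈ copositiveCone n := by
  rw [mem_copositiveCone]
  intro x _
  rw [pairing_symOuter, dotProduct_comm u, add_self_div_two]
  exact mul_self_nonneg _

theorem IsNonnegMatrix.mem_copositiveCone {A : symMatrices n} (hA : IsNonnegMatrix A.1) :
    A ∈ copositiveCone n := fun _ hx =>
  dotProduct_nonneg_of_nonneg hx fun i => dotProduct_nonneg_of_nonneg (hA i) hx

theorem mem_copositiveCone_of_forall_stdSimplex {A : symMatrices n}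
    (h : ∀ x ∈ stdSimplex ℝ (Fin n), 0 ≤ pairing x x A) : A ∈ copositiveCone n := by
  rw [mem_copositiveCone]
  intro x hx
  rcases (Finset.sum_nonneg fun i _ => hx i).eq_or_lt with hsum | hsum
  · have hx0 : x = 0 := funext fun i =>
      (Finset.sum_eq_zero_iff_of_nonneg fun i _ => hx i).1 hsum.symm i (Finset.mem_univ i)
    simp [hx0, pairing_apply]
  · have hmem : (∑ i, x i)⁻¹ • x ∈ stdSimplex ℝ (Fin n) :=
      ⟨smul_nonneg (inv_nonneg.2 hsum.le) hx, by simp [← Finset.mul_sum, hsum.ne']⟩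
    have hnonneg := h _ hmem
    rw [pairing_self_smul] at hnonneg
    exact nonneg_of_mul_nonneg_right hnonneg (by positivity)

theorem neg_sqrt_le_pairing {A : symMatrices n} (hA : A ∈ copositiveCone n) {x y : Fin n → ℝ}
    (hx : 0 ≤ x) (hy : 0 ≤ y) : -√(pairing x x A * pairing y y A) ≤ pairing x y A := by
  have hqx : 0 ≤ pairing x x A := hA x hx
  have hqy : 0 ≤ pairing y y A := hA y hy
  rw [Real.sqrt_mul hqx, neg_le]
  set a := √(pairing x x A)
  set b := √(pairing y y A)
  have ha : a ^ 2 = pairing x x A := Real.sq_sqrt hqx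
  have hb : b ^ 2 = pairing y y A := Real.sq_sqrt hqy
  have hbound (ε : ℝ) (hε : 0 < ε) : -pairing x y A ≤ (a + ε) * (b + ε) := by
    have ha' : 0 < a + ε := by positivity
    have hb' : 0 < b + ε := by positivity
    -- The weights `b`, `a` balance the two squares, as in Cauchy–Schwarz; `ε` makes them positive.
    have hquad := mem_copositiveCone.1 hA _
      (add_nonneg (smul_nonneg hb'.le hx) (smul_nonneg ha'.le hy))
    rw [pairing_self_smul_add_smul, ← ha, ← hb] at hquad
    have hasq : a ^ 2 ≤ (a + ε) ^ 2 := by gcongr; linarith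
    have hbsq : b ^ 2 ≤ (b + ε) ^ 2 := by gcongr; linarith
    have hfactor : 0 ≤ (a + ε) * (b + ε) * ((a + ε) * (b + ε) + pairing x y A) := by
      nlinarith [mul_le_mul_of_nonneg_left hasq (sq_nonneg (b + ε)),
        mul_le_mul_of_nonneg_left hbsq (sq_nonneg (a + ε))]
    linarith [nonneg_of_mul_nonneg_right hfactor (mul_pos ha' hb')]
  have hlim : Filter.Tendsto (fun ε => (a + ε) * (b + ε)) (nhdsWithin 0 (Set.Ioi 0))
      (nhds (a * b)) :=
    (Continuous.tendsto' (by fun_prop) 0 _ (by simp)).mono_left nhdsWithin_le_nhds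
  exact ge_of_tendsto hlim (eventually_mem_nhdsWithin.mono hbound)

theorem pairing_nonneg_of_pairing_self_eq_zero {A : symMatrices n} (hA : A ∈ copositiveCone n)
    {x y : Fin n → ℝ} (hx : 0 ≤ x) (hy : 0 ≤ y) (hyA : pairing y y A = 0) :
    0 ≤ pairing x y A := by
  simpa [hyA] using neg_sqrt_le_pairing hA hx hy

theorem pairing_single_eq_zero_of_pairing_self_eq_zero {A : symMatrices n}
    (hA : A ∈ copositiveCone n) {y : Fin n → ℝ} (hy : 0 ≤ y) (hyA : pairing y y A = 0) {j : Fin n}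
    (hj : 0 < y j) : pairing (Pi.single j 1) y A = 0 := by
  have hterm (i : Fin n) : 0 ≤ y i * pairing (Pi.single i 1) y A :=
    mul_nonneg (hy i) (pairing_nonneg_of_pairing_self_eq_zero hA
      (Pi.single_nonneg.2 zero_le_one) hy hyA)
  have hsum : ∑ i, y i * pairing (Pi.single i 1) y A = 0 := by
    simp only [pairing_apply, single_one_dotProduct]
    exact hyA
  have hj0 := (Finset.sum_eq_zero_iff_of_nonneg fun i _ => hterm i).1 hsum j (Finset.mem_univ j)
  exact (mul_eq_zero.1 hj0).resolve_left hj.ne'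

theorem exists_sub_smul_mem_copositiveCone {A : symMatrices n}
    (hA : ∀ x ∈ stdSimplex ℝ (Fin n), 0 < pairing x x A) (B : symMatrices n) :
    ∃ ε : ℝ, 0 < ε ∧ A - ε • B ∈ copositiveCone n := by
  have hev : ∀ᶠ ε : ℝ in nhds 0, ∀ x ∈ stdSimplex ℝ (Fin n),
      0 < pairing x x A - ε * pairing x x B := by
    refine (isCompact_stdSimplex ℝ (Fin n)).eventually_forall_of_forall_eventually fun x hx => ?_
    have hcont : Continuous fun z : ℝ × (Fin n → ℝ) =>
        pairing z.2 z.2 A - z.1 * pairing z.2 z.2 B :=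
      ((continuous_pairing_self A).comp continuous_snd).sub
        (continuous_fst.mul ((continuous_pairing_self B).comp continuous_snd))
    exact hcont.continuousAt.eventually_const_lt (by simpa using hA x hx)
  obtain ⟨ε, hε, hpos⟩ := ((eventually_mem_nhdsWithin (s := Set.Ioi (0 : ℝ))).and
    (hev.filter_mono nhdsWithin_le_nhds)).exists
  refine ⟨ε, hε, mem_copositiveCone_of_forall_stdSimplex fun x hx => ?_⟩
  simpa using (hpos x hx).le

-- Without a common zero, a finite sum of forms spanning the face would be strictly copositive,
-- hence interior to the cone, where `φ ≠ 0` cannot vanish.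
theorem exists_stdSimplex_pairing_self_eq_zero {φ : symMatrices n →ₗ[ℝ] ℝ} (hφ0 : φ ≠ 0)
    (hφ : ∀ A ∈ copositiveCone n, 0 ≤ φ A) :
    ∃ y ∈ stdSimplex ℝ (Fin n), ∀ A ∈ copositiveCone n, φ A = 0 → pairing y y A = 0 := by
  obtain ⟨t, ht, hspan⟩ := (Submodule.fg_span_iff_fg_span_finset_subset
    {A | A ∈ copositiveCone n ∧ φ A = 0}).1
      (IsNoetherian.noetherian (R := ℝ) (M := symMatrices n) _)
  obtain ⟨y, hy, hysum⟩ : ∃ y ∈ stdSimplex ℝ (Fin n), pairing y y (∑ A ∈ t, A) ≤ 0 := by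
    by_contra! hpos
    obtain ⟨B, hB⟩ := LinearMap.surjective hφ0 1
    obtain ⟨ε, hε, hmem⟩ := exists_sub_smul_mem_copositiveCone hpos B
    have hsum : φ (∑ A ∈ t, A) = 0 := by
      rw [map_sum]
      exact Finset.sum_eq_zero fun A hA => (ht hA).2
    have hnonneg := hφ _ hmem
    rw [map_sub, map_smul, hsum, hB, smul_eq_mul] at hnonneg
    linarith
  refine ⟨y, hy, fun A hA hφA => ?_⟩
  have hvanish : Submodule.span ℝ (t : Set (symMatrices n)) ≤ LinearMap.ker (pairing y y) := by
    have hterm (B) (hB : B ∈ t) : 0 ≤ pairing y y B := (ht hB).1 y hy.1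
    rw [map_sum] at hysum
    exact Submodule.span_le.2 ((Finset.sum_eq_zero_iff_of_nonneg hterm).1
      (hysum.antisymm (Finset.sum_nonneg hterm)))
  exact hvanish (hspan ▸ Submodule.subset_span ⟨hA, hφA⟩)

/-- A facet of the copositive cone, given by its supporting functional `φ`: the exposed face
`{A ∈ COP | φ A = 0}` spans the whole hyperplane `ker φ`. -/
structure IsFacetFunctional (φ : symMatrices n →ₗ[ℝ] ℝ) : Prop where
  ne_zero : φ ≠ 0
  nonneg : ∀ A ∈ copositiveCone n, 0 ≤ φ A
  ker_le_span : LinearMap.ker φ ≤ Submodule.span ℝ {A | A ∈ copositiveCone n ∧ φ A = 0}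

theorem isFacetFunctional_diag (i : Fin n) :
    IsFacetFunctional (pairing (Pi.single i 1) (Pi.single i 1)) where
  ne_zero h := by
    simpa using LinearMap.congr_fun h (symOuter (Pi.single i 1) (Pi.single i 1))
  nonneg _ hA := mem_copositiveCone.1 hA _ (Pi.single_nonneg.2 zero_le_one)
  ker_le_span A hA := by
    have hAii : A.1 i i = 0 := by simpa using hA
    rw [eq_sum_smul_symOuter_single A]
    refine Submodule.sum_mem _ fun k _ => Submodule.sum_mem _ fun l _ => ?_
    by_cases hkl : k = i ∧ l = i
    · rw [hkl.1, hkl.2, hAii, zero_smul]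
      exact Submodule.zero_mem _
    · refine Submodule.smul_mem _ _ (Submodule.subset_span ⟨symOuter_mem_copositiveCone
        (Pi.single_nonneg.2 zero_le_one) (Pi.single_nonneg.2 zero_le_one), ?_⟩)
      rw [pairing_single_single, symOuter_apply]
      simp only [Pi.single_apply]
      grind

theorem IsFacetFunctional.comp {φ : symMatrices n →ₗ[ℝ] ℝ} (hφ : IsFacetFunctional φ)
    {e : symMatrices n ≃ₗ[ℝ] symMatrices n}
    (he : ∀ A, e A ∈ copositiveCone n ↔ A ∈ copositiveCone n) :
    IsFacetFunctional (φ ∘ₗ e.toLinearMap) where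
  ne_zero h := hφ.ne_zero <| LinearMap.ext fun A => by
    simpa using LinearMap.congr_fun h (e.symm A)
  nonneg A hA := hφ.nonneg _ ((he A).2 hA)
  ker_le_span A hA := by
    have hspan := Submodule.mem_map_of_mem (f := e.symm.toLinearMap) (hφ.ker_le_span hA)
    rw [Submodule.map_span] at hspan
    have himage : e.symm '' {B | B ∈ copositiveCone n ∧ φ B = 0} ⊆
        {B | B ∈ copositiveCone n ∧ φ (e B) = 0} := by
      rintro _ ⟨B, ⟨hB, hφB⟩, rfl⟩
      exact ⟨(he _).1 (by simpa using hB), by simpa using hφB⟩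
    simpa using Submodule.span_mono himage hspan

theorem exists_eq_smul_of_ker_le_ker {K V : Type*} [Field K] [AddCommGroup V] [Module K V]
    {φ ψ : V →ₗ[K] K} (h : LinearMap.ker φ ≤ LinearMap.ker ψ) : ∃ c : K, ψ = c • φ := by
  have hmem := mem_span_of_iInf_ker_le_ker (L := fun _ : Unit => φ) (by simpa using h)
  rw [Set.range_const, Submodule.mem_span_singleton] at hmem
  exact hmem.imp fun _ => Eq.symm

theorem apply_eq_zero_of_ker_pairing_self_le {y : Fin n → ℝ} {j k : Fin n} (hjk : k ≠ j)
    (hj : y j ≠ 0)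
    (h : LinearMap.ker (pairing y y) ≤ LinearMap.ker (pairing (Pi.single j 1) y)) : y k = 0 := by
  set u : Fin n → ℝ := Pi.single j (y k) - Pi.single k (y j) with hu
  have huy : u ⬝ᵥ y = 0 := by simp [hu, sub_dotProduct, mul_comm]
  have hself : symOuter u (Pi.single j 1) ∈ LinearMap.ker (pairing y y) := by
    simp [pairing_symOuter, dotProduct_comm y u, huy]
  have hrow := h hself
  rw [LinearMap.mem_ker, pairing_symOuter, huy] at hrow
  simpa [hu, hjk.symm, hj] using hrow

theorem IsFacetFunctional.exists_eq_mul_diag {φ : symMatrices n →ₗ[ℝ] ℝ}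
    (hφ : IsFacetFunctional φ) : ∃ j, ∃ c > 0, ∀ A, φ A = c * A.1 j j := by
  obtain ⟨y, hy, hzero⟩ := exists_stdSimplex_pairing_self_eq_zero hφ.ne_zero hφ.nonneg
  have hker : LinearMap.ker φ ≤ LinearMap.ker (pairing y y) :=
    hφ.ker_le_span.trans (Submodule.span_le.2 fun A hA => hzero A hA.1 hA.2)
  obtain ⟨a, ha⟩ := exists_eq_smul_of_ker_le_ker hker
  obtain ⟨j, -, hj⟩ := (Finset.sum_pos_iff_of_nonneg fun i _ => hy.1 i).1
    (hy.2 ▸ zero_lt_one : 0 < ∑ i, y i)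
  have hker' : LinearMap.ker φ ≤ LinearMap.ker (pairing (Pi.single j 1) y) :=
    hφ.ker_le_span.trans (Submodule.span_le.2 fun A hA =>
      pairing_single_eq_zero_of_pairing_self_eq_zero hA.1 hy.1 (hzero A hA.1 hA.2) hj)
  have ha_pos : 0 < a := by
    have hval := LinearMap.congr_fun ha (symOuter (Pi.single j 1) (Pi.single j 1))
    simp only [pairing_symOuter, dotProduct_single_one, single_one_dotProduct, add_self_div_two,
      LinearMap.smul_apply, smul_eq_mul] at hval
    exact pos_of_mul_pos_left (hval ▸ mul_pos hj hj)
      (hφ.nonneg _ (symOuter_self_mem_copositiveCone _))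
  have hy_off (k : Fin n) (hk : k ≠ j) : y k = 0 := by
    refine apply_eq_zero_of_ker_pairing_self_le hk hj.ne' ?_
    rwa [ha, LinearMap.ker_smul _ _ ha_pos.ne']
  have hy_eq : y = Pi.single j 1 := by
    have hyj : y j = 1 := by
      rw [← hy.2, Finset.sum_eq_single j (fun k _ => hy_off k) (by simp)]
    ext k
    rcases eq_or_ne k j with rfl | hk
    · rw [hyj, Pi.single_eq_same]
    · rw [hy_off k hk, Pi.single_eq_of_ne hk]
  refine ⟨j, a⁻¹, inv_pos.2 ha_pos, fun A => ?_⟩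
  have hA := LinearMap.congr_fun ha A
  rw [hy_eq, pairing_single_single, one_mul, mul_one, LinearMap.smul_apply, smul_eq_mul] at hA
  rw [hA, inv_mul_cancel_left₀ ha_pos.ne']

theorem exists_perm_diag_eq {e : symMatrices n ≃ₗ[ℝ] symMatrices n}
    (he : ∀ A, e A ∈ copositiveCone n ↔ A ∈ copositiveCone n) :
    ∃ (σ : Equiv.Perm (Fin n)) (c : Fin n → ℝ), (∀ i, 0 < c i) ∧
      ∀ A i, (e A).1 i i = c i * A.1 (σ i) (σ i) := by
  have hfacet (i : Fin n) := ((isFacetFunctional_diag i).comp he).exists_eq_mul_diag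
  choose σ c hc hdiag using hfacet
  simp only [LinearMap.comp_apply, LinearEquiv.coe_coe, pairing_single_single, one_mul,
    mul_one] at hdiag
  have hσ : Function.Injective σ := by
    intro i k hik
    by_contra hne
    have hi := hdiag i (e.symm (symOuter (Pi.single i 1) (Pi.single i 1)))
    have hk := hdiag k (e.symm (symOuter (Pi.single i 1) (Pi.single i 1)))
    simp only [e.apply_symm_apply, symOuter_apply] at hi hk
    have hσi : (e.symm (symOuter (Pi.single i 1) (Pi.single i 1))).1 (σ i) (σ i) = 0 := by
      simpa [← hik, (hc k).ne', hne] using hk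
    simp [hσi] at hi
  exact ⟨Equiv.ofBijective σ hσ.bijective_of_finite, c, hc, fun A i => hdiag i A⟩

theorem symOuter_self_apply_le_of_diag_eq {u : Fin n → ℝ} (hu : ∀ k l, k ≠ l → u k * u l ≤ 0)
    {A : symMatrices n} (hA : A ∈ copositiveCone n)
    (hdiag : ∀ k, A.1 k k = (symOuter u u).1 k k) (k l : Fin n) :
    (symOuter u u).1 k l ≤ A.1 k l := by
  rcases eq_or_ne k l with rfl | hkl
  · exact (hdiag k).ge
  · have hbound := neg_sqrt_le_pairing hA (x := Pi.single k 1) (y := Pi.single l 1)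
      (Pi.single_nonneg.2 zero_le_one) (Pi.single_nonneg.2 zero_le_one)
    simp only [pairing_single_single, one_mul, mul_one, hdiag, symOuter_apply,
      add_self_div_two] at hbound ⊢
    rwa [mul_mul_mul_comm, Real.sqrt_mul_self_eq_abs, abs_of_nonpos (hu k l hkl), neg_neg] at hbound

theorem isNonnegMatrix_of_diag_eq_zero {A : symMatrices n} (hA : A ∈ copositiveCone n)
    (hdiag : ∀ k, A.1 k k = 0) : IsNonnegMatrix A.1 := fun k l => by
  simpa using symOuter_self_apply_le_of_diag_eq (u := 0) (by simp) hA (by simpa using hdiag) k l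

-- Both `e S` and `e⁻¹ S` are copositive with the diagonal of `S = u uᵀ`, so `S` lies entrywise
-- below both of them; the bound on `e⁻¹ S` becomes the reverse bound on `e S` by applying `e`.
theorem apply_symOuter_self_eq {e : symMatrices n ≃ₗ[ℝ] symMatrices n}
    (he : ∀ A, e A ∈ copositiveCone n ↔ A ∈ copositiveCone n)
    (hdiag : ∀ A k, (e A).1 k k = A.1 k k) {u : Fin n → ℝ}
    (hu : ∀ k l, k ≠ l → u k * u l ≤ 0) : e (symOuter u u) = symOuter u u := by
  set S := symOuter u u
  have hS : S ∈ copositiveCone n := symOuter_self_mem_copositiveCone u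
  have hle := symOuter_self_apply_le_of_diag_eq hu ((he S).2 hS) (hdiag S)
  have hsymm_le := symOuter_self_apply_le_of_diag_eq hu (A := e.symm S)
    ((he _).1 (by rwa [e.apply_symm_apply])) fun k => by rw [← hdiag, e.apply_symm_apply]
  have hsub : S - e S ∈ copositiveCone n := by
    have hsymm_sub : IsNonnegMatrix (e.symm S - S).1 := fun k l => sub_nonneg.2 (hsymm_le k l)
    simpa only [map_sub, e.apply_symm_apply] using (he _).2 hsymm_sub.mem_copositiveCone
  have hge := isNonnegMatrix_of_diag_eq_zero hsub fun k => sub_eq_zero.2 (hdiag S k).symm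
  ext k l
  exact le_antisymm (sub_nonneg.1 (hge k l)) (hle k l)

theorem apply_eq_self_of_diag_eq {e : symMatrices n ≃ₗ[ℝ] symMatrices n}
    (he : ∀ A, e A ∈ copositiveCone n ↔ A ∈ copositiveCone n)
    (hdiag : ∀ A k, (e A).1 k k = A.1 k k) (A : symMatrices n) : e A = A := by
  have hsingle (i : Fin n) := apply_symOuter_self_eq he hdiag (u := Pi.single i 1) fun k l hkl => by
    simp only [Pi.single_apply]
    split_ifs <;> simp_all
  have hdiff (i j : Fin n) := apply_symOuter_self_eq he hdiag
    (u := Pi.single i 1 - Pi.single j 1) fun k l hkl => by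
      simp only [Pi.sub_apply, Pi.single_apply]
      split_ifs <;> simp_all
  refine LinearMap.congr_fun (f := e.toLinearMap) (g := LinearMap.id)
    (linearMap_ext_symOuter_single fun i j => ?_) A
  rw [symOuter_eq_half_smul, LinearEquiv.coe_coe, map_smul, map_sub, map_add, hsingle, hsingle,
    hdiff, LinearMap.id_apply]

/-- The linear map `A ↦ Q A Qᵀ` on symmetric matrices. -/
def congruence (Q : Matrix (Fin n) (Fin n) ℝ) : symMatrices n →ₗ[ℝ] symMatrices n where
  toFun A := ⟨Q * A.1 * Qᵀ, by
    change (Q * A.1 * Qᵀ)ᵀ = _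
    rw [transpose_mul, transpose_mul, transpose_transpose, show A.1ᵀ = A.1 from A.2,
      Matrix.mul_assoc]⟩
  map_add' A B := by ext1; simp [Matrix.mul_add, Matrix.add_mul]
  map_smul' c A := by ext1; simp

theorem coe_congruence (Q : Matrix (Fin n) (Fin n) ℝ) (A : symMatrices n) :
    (congruence Q A).1 = Q * A.1 * Qᵀ := rfl

theorem congruence_mul_apply (Q R : Matrix (Fin n) (Fin n) ℝ) (A : symMatrices n) :
    congruence (Q * R) A = congruence Q (congruence R A) := by
  ext1
  simp only [coe_congruence, transpose_mul, Matrix.mul_assoc]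

theorem congruence_one_apply (A : symMatrices n) : congruence 1 A = A := by
  ext1
  simp [coe_congruence]

theorem pairing_congruence (Q : Matrix (Fin n) (Fin n) ℝ) (x y : Fin n → ℝ)
    (A : symMatrices n) : pairing x y (congruence Q A) = pairing (Qᵀ *ᵥ x) (Qᵀ *ᵥ y) A := by
  rw [pairing_apply, pairing_apply, coe_congruence, ← mulVec_mulVec, ← mulVec_mulVec,
    dotProduct_mulVec, ← mulVec_transpose]

theorem IsNonnegMatrix.congruence_mem_copositiveCone {Q : Matrix (Fin n) (Fin n) ℝ}
    (hQ : IsNonnegMatrix Q) {A : symMatrices n} (hA : A ∈ copositiveCone n) :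
    congruence Q A ∈ copositiveCone n := by
  rw [_root_.mem_copositiveCone] at hA ⊢
  intro x hx
  rw [pairing_congruence]
  exact hA _ fun i => dotProduct_nonneg_of_nonneg (fun j => hQ j i) hx

theorem IsMonomialMatrix.exists_isNonnegMatrix_mul_eq_one {Q : Matrix (Fin n) (Fin n) ℝ}
    (hQ : IsMonomialMatrix Q) (hQ0 : IsNonnegMatrix Q) :
    ∃ R : Matrix (Fin n) (Fin n) ℝ, IsNonnegMatrix R ∧ Q * R = 1 := by
  refine ⟨of fun j i => (Q i j)⁻¹, fun j i => inv_nonneg.2 (hQ0 i j), ?_⟩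
  ext i k
  obtain ⟨j, hij, hj_unique⟩ := hQ.1 i
  have hrow (l : Fin n) (hl : l ≠ j) : Q i l = 0 := of_not_not (mt (hj_unique l) hl)
  rw [mul_apply, Finset.sum_eq_single j (fun l _ hl => by rw [hrow l hl, zero_mul]) (by simp),
    of_apply]
  rcases eq_or_ne i k with rfl | hik
  · rw [one_apply_eq, mul_inv_cancel₀ hij]
  · have hkj : Q k j = 0 := of_not_not fun hkj => hik ((hQ.2 j).unique hij hkj)
    rw [one_apply_ne hik, hkj, _root_.inv_zero, mul_zero]

theorem IsMonomialMatrix.congruence_image_copositiveCone {Q : Matrix (Fin n) (Fin n) ℝ}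
    (hQ : IsMonomialMatrix Q) (hQ0 : IsNonnegMatrix Q) :
    congruence Q '' copositiveCone n = copositiveCone n := by
  obtain ⟨R, hR0, hQR⟩ := hQ.exists_isNonnegMatrix_mul_eq_one hQ0
  refine Set.Subset.antisymm (Set.image_subset_iff.2 fun A => hQ0.congruence_mem_copositiveCone)
    fun B hB => ⟨congruence R B, hR0.congruence_mem_copositiveCone hB, ?_⟩
  rw [← congruence_mul_apply, hQR, congruence_one_apply]

theorem exists_linearEquiv_of_image_copositiveCone {L : symMatrices n →ₗ[ℝ] symMatrices n}
    (hL : L '' copositiveCone n = copositiveCone n) :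
    ∃ e : symMatrices n ≃ₗ[ℝ] symMatrices n, e.toLinearMap = L ∧
      ∀ A, e A ∈ copositiveCone n ↔ A ∈ copositiveCone n := by
  have hsurj : Function.Surjective L := by
    rw [← LinearMap.range_eq_top, eq_top_iff]
    intro A _
    rw [eq_sum_smul_symOuter_single A]
    refine Submodule.sum_mem _ fun i _ => Submodule.sum_mem _ fun j _ =>
      Submodule.smul_mem _ _ ?_
    have hmem : symOuter (Pi.single i 1) (Pi.single j 1) ∈ L '' copositiveCone n := by
      rw [hL]
      exact symOuter_mem_copositiveCone (Pi.single_nonneg.2 zero_le_one)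
        (Pi.single_nonneg.2 zero_le_one)
    exact Set.image_subset_range _ _ hmem
  have hinj : Function.Injective L := LinearMap.injective_iff_surjective.2 hsurj
  have hmem_iff (A) : L A ∈ copositiveCone n ↔ A ∈ copositiveCone n := by
    rw [← hinj.mem_set_image (a := A), hL]
  exact ⟨LinearEquiv.ofBijective L ⟨hinj, hsurj⟩, rfl, hmem_iff⟩

theorem eq_of_image_copositiveCone_of_diag_eq {L M : symMatrices n →ₗ[ℝ] symMatrices n}
    (hL : L '' copositiveCone n = copositiveCone n)
    (hM : M '' copositiveCone n = copositiveCone n)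
    (hdiag : ∀ A i, (L A).1 i i = (M A).1 i i) : L = M := by
  obtain ⟨e, rfl, he⟩ := exists_linearEquiv_of_image_copositiveCone hL
  obtain ⟨f, rfl, hf⟩ := exists_linearEquiv_of_image_copositiveCone hM
  have hrefl := apply_eq_self_of_diag_eq (e := f.symm.trans e)
    (fun A => by rw [LinearEquiv.trans_apply, he, ← hf, f.apply_symm_apply])
    (fun A k => by simpa using hdiag (f.symm A) k)
  ext1 A
  simpa using hrefl (f A)

/-- The monomial matrix whose `i`-th row is `d i` times the unit row vector at `σ i`. -/
def monomialMatrix (σ : Equiv.Perm (Fin n)) (d : Fin n → ℝ) : Matrix (Fin n) (Fin n) ℝ :=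
  of fun i => Pi.single (σ i) (d i)

theorem isMonomialMatrix_monomialMatrix (σ : Equiv.Perm (Fin n)) {d : Fin n → ℝ}
    (hd : ∀ i, d i ≠ 0) : IsMonomialMatrix (monomialMatrix σ d) := by
  have hne (i j) : monomialMatrix σ d i j ≠ 0 ↔ j = σ i := by
    simp [monomialMatrix, Pi.single_apply, hd]
  simp only [IsMonomialMatrix, hne]
  exact ⟨fun i => ⟨σ i, rfl, fun j hj => hj⟩,
    fun j => ⟨σ.symm j, by simp, fun i hi => by simp [hi]⟩⟩

theorem isNonnegMatrix_monomialMatrix (σ : Equiv.Perm (Fin n)) {d : Fin n → ℝ} (hd : 0 ≤ d) :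
    IsNonnegMatrix (monomialMatrix σ d) := fun i =>
  (Pi.single_nonneg.2 (hd i) : (0 : Fin n → ℝ) ≤ Pi.single (σ i) (d i))

theorem congruence_monomialMatrix_apply (σ : Equiv.Perm (Fin n)) (d : Fin n → ℝ)
    (A : symMatrices n) (i j : Fin n) :
    (congruence (monomialMatrix σ d) A).1 i j = d i * A.1 (σ i) (σ j) * d j := by
  have hrow (i : Fin n) : (monomialMatrix σ d)ᵀ *ᵥ Pi.single i 1 = Pi.single (σ i) (d i) := by
    rw [mulVec_single_one]
    rfl
  have h := pairing_congruence (monomialMatrix σ d) (Pi.single i 1) (Pi.single j 1) A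
  simpa only [hrow, pairing_single_single, one_mul, mul_one] using h

theorem exists_monomial_diag_eq {L : symMatrices n →ₗ[ℝ] symMatrices n}
    (hL : L '' copositiveCone n = copositiveCone n) :
    ∃ Q : Matrix (Fin n) (Fin n) ℝ, IsMonomialMatrix Q ∧ IsNonnegMatrix Q ∧
      ∀ A i, (L A).1 i i = (congruence Q A).1 i i := by
  obtain ⟨e, rfl, he⟩ := exists_linearEquiv_of_image_copositiveCone hL
  obtain ⟨σ, c, hc, hdiag⟩ := exists_perm_diag_eq he
  refine ⟨monomialMatrix σ fun i => √(c i),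
    isMonomialMatrix_monomialMatrix σ fun i => (Real.sqrt_pos.2 (hc i)).ne',
    isNonnegMatrix_monomialMatrix σ fun i => Real.sqrt_nonneg _, fun A i => ?_⟩
  rw [LinearEquiv.coe_coe, hdiag, congruence_monomialMatrix_apply, mul_right_comm,
    Real.mul_self_sqrt (hc i).le]

end

theorem mainTheorem2 (n : ℕ) (L : symMatrices n →ₗ[ℝ] symMatrices n) :
    L '' copositiveCone n = copositiveCone n ↔
      ∃ Q : Matrix (Fin n) (Fin n) ℝ, IsMonomialMatrix Q ∧ IsNonnegMatrix Q ∧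
        ∀ A : symMatrices n,
          (L A : Matrix (Fin n) (Fin n) ℝ) = Q * (A : Matrix (Fin n) (Fin n) ℝ) * Qᵀ := by
  constructor
  · intro hL
    obtain ⟨Q, hQ, hQ0, hdiag⟩ := exists_monomial_diag_eq hL
    have hLQ : L = congruence Q := eq_of_image_copositiveCone_of_diag_eq hL
      (hQ.congruence_image_copositiveCone hQ0) hdiag
    exact ⟨Q, hQ, hQ0, fun A => by rw [hLQ, coe_congruence]⟩
  · rintro ⟨Q, hQ, hQ0, hLQ⟩
    have hL : L = congruence Q := LinearMap.ext fun A => Subtype.ext (hLQ A)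
    rw [hL, hQ.congruence_image_copositiveCone hQ0]
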